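/- For a probability measure $\pi$ on $\mathbb{R}^2$ let $\mathsf{LSI}(\pi)\in[0,\infty]$ denote its log-Sobolev constant, i.e. the smallest $C$ such that $$\mathsf{KL}(\rho\,\|\,\pi)\le C\cdot\mathsf{FI}(\rho\,\|\,\pi),\qquad \mathsf{FI}(\rho\,\|\,\pi)=\mathbb{E}_\rho\Big\|\nabla\log\frac{d\rho}{d\pi}\Big\|^2,$$ for all probability measures $\rho$ (with $\mathsf{FI}=\infty$ if $\rho$ has no positive $C^1$ density with respect to $\pi$; if $\pi$ lives on a curve, $\mathsf{FI}$ is the infimum of the right-hand side over all positive $C^1$ functions on $\mathbb{R}^2$ that represent the density). Let $R(x)=\|x\|^2$ and let $\pi_R\propto\pi e^{-R}$ be the tilted probability measure. Then $\mathsf{LSI}(\pi)$ and $\mathsf{LSI}(\pi_R)$ cannot be compared in general, in the following sense. For every $\ell>0$: 1. There is a $\pi$ with $\mathsf{LSI}(\pi)<\ell^2$ and $\mathsf{LSI}(\pi_R)>e^{\ell^2}$. It can be taken to be the uniform measure (normalized arc length) on a set of the form $$\{-w\}\times[a,b]\;\cup\;[-w,w]\times\{b\}\;\cup\;\{w\}\times[a,b],\qquad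 w>0,\ 0\le a<b.$$ 2. The uniform measure $\pi$ on the segment $[-e^\ell,e^\ell]\times\{0\}$ satisfies $\mathsf{LSI}(\pi)>0.1\,e^{\ell}$ and $\mathsf{LSI}(\pi_R)<2$. -/

import Mathlib

open MeasureTheory
open scoped ENNReal

noncomputable section

namespace LogSobolevTilt

section General

variable {E : Type*} [NormedAddCommGroup E] [InnerProductSpace ℝ E] [CompleteSpace E]
  [MeasurableSpace E]

/-- Relative Fisher information (Fisher divergence) `FI(ρ ‖ π) = 𝔼_ρ ‖∇ log (dρ/dπ)‖²`.
The density `dρ/dπ` is represented by a positive `C¹` function `g` on the ambient space. When `π`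
is carried by a null set such as a curve, `g` is determined by `ρ` only on the support of `π`; the
infimum runs over all such `g`, so that only the part of the gradient seen by `π` counts (on a
curve: the derivative along the curve). It is `∞` when there is no such density. -/
def fisherDiv (ρ π : Measure E) : ℝ≥0∞ :=
  ⨅ (g : E → ℝ) (_ : ContDiff ℝ 1 g) (_ : ∀ x, 0 < g x)
    (_ : ρ = π.withDensity (fun x => ENNReal.ofReal (g x))),
      ∫⁻ x, ‖gradient (fun y => Real.log (g y)) x‖ₑ ^ 2 ∂ρ

/-- The log-Sobolev constant `LSI(π)`: the smallest `C ∈ [0, ∞]` such that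
`KL(ρ ‖ π) ≤ C · FI(ρ ‖ π)` for every probability measure `ρ`. -/
def logSobolevConst (π : Measure E) : ℝ≥0∞ :=
  sInf {C : ℝ≥0∞ | ∀ ρ : Measure E, IsProbabilityMeasure ρ →
    InformationTheory.klDiv ρ π ≤ C * fisherDiv ρ π}

end General

/-- The Euclidean plane. -/
abbrev Plane : Type := EuclideanSpace ℝ (Fin 2)

/-- The uniform probability measure on a set `s ⊆ ℝ²` of finite positive length: normalized
one-dimensional Hausdorff measure (arc length) on `s`. -/
def uniformMeasure (s : Set Plane) : Measure Plane :=
  ProbabilityTheory.cond (Measure.hausdorffMeasure 1) s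

/-- The tilt `π_R ∝ π e^{-R}`, normalized to a probability measure. -/
def tilt (π : Measure Plane) (R : Plane → ℝ) : Measure Plane :=
  π.tilted (fun x => -R x)

/-- Two vertical bars `{∓w} × [a, b]`, joined at their upper ends by the horizontal bar
`[-w, w] × {b}`. -/
def bridge (w a b : ℝ) : Set Plane :=
  segment ℝ !₂[-w, a] !₂[-w, b] ∪ segment ℝ !₂[-w, b] !₂[w, b] ∪ segment ℝ !₂[w, a] !₂[w, b]

end LogSobolevTilt

end

/-! For a density `g` of class `C¹` and mass one, the log-Sobolev inequality compares `∫ klFun g`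
with `∫ ‖∇g‖² / g`, so each estimate concerns these two integrals (`logSobolevConst_le`,
`le_logSobolevConst`).

Bridge. A connected curve of length `T` has constant at most `T²` (`logSobolevConst_le_sq`): `g`
oscillates by at most the integral of `‖∇g‖` along the curve. A small bridge is therefore good
wherever it stands. Lifted to a great height `a`, it gets a tilt that makes the top bar
exponentially lighter than the legs. The density `1 + ε sin (π x₀ / 2w)` varies only on that bar but
differs from `1` on both legs; its Fisher information is tiny and its entropy is not, so the
constant blows up (`le_logSobolevConst_tilt_bridge`).

Segment. The same sine on `[-L, L]` gives a lower bound of order `L²`. After the tilt the measure is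
a truncated Gaussian with potential `x²`, whose second derivative is `2`; monotone transport gives
the Bakry-Émery constant `1/4`, whatever `L` is (`integral_mul_log_mul_exp_neg_sq_le`). -/

namespace LogSobolevTilt

open InformationTheory

/-! ### Log-Sobolev constants as inequalities between real integrals -/

section General

variable {E : Type*} [NormedAddCommGroup E] [InnerProductSpace ℝ E] [CompleteSpace E]
  [MeasurableSpace E] [BorelSpace E] [SecondCountableTopology E]

/-- A continuous function is integrable for a finite measure carried by a compact set. -/
theorem integrable_of_continuous_of_isCompact {X : Type*} [TopologicalSpace X] [MeasurableSpace X]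
    [OpensMeasurableSpace X] [SecondCountableTopology X] [T2Space X]
    {π : Measure X} [IsFiniteMeasure π] {K : Set X}
    (hK : IsCompact K) (hπ : π Kᶜ = 0) {F : X → ℝ} (hF : Continuous F) : Integrable F π := by
  obtain ⟨B, hB⟩ := hK.exists_bound_of_continuousOn hF.continuousOn
  refine Integrable.of_bound (hF.measurable.aestronglyMeasurable) B ?_
  have : ∀ᵐ x ∂π, x ∈ K := by
    rw [ae_iff]; exact hπ
  filter_upwards [this] with x hx using hB x hx

theorem klDiv_withDensity_eq {X : Type*} [MeasurableSpace X] {π : Measure X} [IsFiniteMeasure π]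
    {g : X → ℝ} (hg : Measurable g) (hpos : ∀ x, 0 < g x) (hint : Integrable g π)
    (hkl : Integrable (fun x => klFun (g x)) π) :
    klDiv (π.withDensity fun x => ENNReal.ofReal (g x)) π
      = ENNReal.ofReal (∫ x, klFun (g x) ∂π) := by
  have hm : Measurable fun x => ENNReal.ofReal (g x) := hg.ennreal_ofReal
  have : IsFiniteMeasure (π.withDensity fun x => ENNReal.ofReal (g x)) :=
    isFiniteMeasure_withDensity_ofReal hint.2
  rw [klDiv_eq_lintegral_klFun_of_ac (withDensity_absolutelyContinuous _ _),
    ofReal_integral_eq_lintegral_ofReal hkl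
      (Filter.Eventually.of_forall fun x => klFun_nonneg (hpos x).le)]
  refine lintegral_congr_ae ?_
  filter_upwards [Measure.rnDeriv_withDensity π hm] with x hx
  rw [hx, ENNReal.toReal_ofReal (hpos x).le]

theorem continuous_fderiv_sq_div {E : Type*} [NormedAddCommGroup E] [NormedSpace ℝ E] {g : E → ℝ} (hg : ContDiff ℝ 1 g) (hpos : ∀ x, 0 < g x) :
    Continuous fun x => ‖fderiv ℝ g x‖ ^ 2 / g x :=
  ((hg.continuous_fderiv one_ne_zero).norm.pow 2).div hg.continuous fun x => (hpos x).ne'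

theorem enorm_gradient_log_sq_mul {E : Type*} [NormedAddCommGroup E] [InnerProductSpace ℝ E]
    [CompleteSpace E] {g : E → ℝ} (hg : ContDiff ℝ 1 g) (hpos : ∀ x, 0 < g x) (x : E) :
    ENNReal.ofReal (g x) * ‖gradient (fun y => Real.log (g y)) x‖ₑ ^ 2
      = ENNReal.ofReal (‖fderiv ℝ g x‖ ^ 2 / g x) := by
  have hd : DifferentiableAt ℝ g x := hg.differentiable one_ne_zero x
  have h1 : ‖gradient (fun y => Real.log (g y)) x‖ = (g x)⁻¹ * ‖fderiv ℝ g x‖ := by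
    rw [gradient, LinearIsometryEquiv.norm_map, fderiv.log hd (hpos x).ne', norm_smul,
      Real.norm_of_nonneg (inv_nonneg.2 (hpos x).le)]
  rw [← ofReal_norm, h1, ← ENNReal.ofReal_pow (by have := (hpos x).le; positivity),
    ← ENNReal.ofReal_mul (hpos x).le]
  congr 1
  have := (hpos x).ne'
  field_simp

theorem lintegral_gradient_log_sq {π : Measure E} [IsFiniteMeasure π] {K : Set E}
    (hK : IsCompact K) (hπ : π Kᶜ = 0) {g : E → ℝ} (hg : ContDiff ℝ 1 g) (hpos : ∀ x, 0 < g x) :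
    ∫⁻ x, ‖gradient (fun y => Real.log (g y)) x‖ₑ ^ 2 ∂(π.withDensity fun x => ENNReal.ofReal (g x))
      = ENNReal.ofReal (∫ x, ‖fderiv ℝ g x‖ ^ 2 / g x ∂π) := by
  rw [lintegral_withDensity_eq_lintegral_mul_non_measurable _ hg.continuous.measurable.ennreal_ofReal
    (Filter.Eventually.of_forall fun x => ENNReal.ofReal_lt_top),
    ofReal_integral_eq_lintegral_ofReal
      (integrable_of_continuous_of_isCompact hK hπ (continuous_fderiv_sq_div hg hpos))
      (Filter.Eventually.of_forall fun x => div_nonneg (sq_nonneg _) (hpos x).le)]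
  exact lintegral_congr fun x => enorm_gradient_log_sq_mul hg hpos x

theorem klDiv_withDensity_of_isCompact {X : Type*} [TopologicalSpace X] [MeasurableSpace X]
    [OpensMeasurableSpace X] [SecondCountableTopology X] [T2Space X]
    {π : Measure X} [IsFiniteMeasure π] {K : Set X}
    (hK : IsCompact K) (hπ : π Kᶜ = 0) {g : X → ℝ} (hg : Continuous g) (hpos : ∀ x, 0 < g x) :
    klDiv (π.withDensity fun x => ENNReal.ofReal (g x)) π
      = ENNReal.ofReal (∫ x, klFun (g x) ∂π) :=
  klDiv_withDensity_eq hg.measurable hpos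
    (integrable_of_continuous_of_isCompact hK hπ hg)
    (integrable_of_continuous_of_isCompact hK hπ (continuous_klFun.comp hg))

/-- A log-Sobolev inequality for `C¹` densities bounds the log-Sobolev constant from above. -/
theorem logSobolevConst_le {π : Measure E} [IsFiniteMeasure π] {K : Set E}
    (hK : IsCompact K) (hπ : π Kᶜ = 0) {C : ℝ} (hC : 0 < C)
    (h : ∀ g : E → ℝ, ContDiff ℝ 1 g → (∀ x, 0 < g x) → ∫ x, g x ∂π = 1 →
      ∫ x, klFun (g x) ∂π ≤ C * ∫ x, ‖fderiv ℝ g x‖ ^ 2 / g x ∂π) :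
    logSobolevConst π ≤ ENNReal.ofReal C := by
  refine sInf_le fun ρ hρ => ?_
  have hC0 : ENNReal.ofReal C ≠ 0 := by simpa using hC
  -- A factor that is neither `0` nor `∞` passes through the infimum, so each representative `g` can
  -- be treated separately.
  simp only [fisherDiv, ENNReal.mul_iInf_of_ne hC0 ENNReal.ofReal_ne_top, le_iInf_iff]
  rintro g hg hpos rfl
  have hint := integrable_of_continuous_of_isCompact hK hπ hg.continuous
  have h1 : ∫ x, g x ∂π = 1 := by
    have h2 := hρ.measure_univ
    rw [withDensity_apply _ MeasurableSet.univ, Measure.restrict_univ,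
      ← ofReal_integral_eq_lintegral_ofReal hint
        (Filter.Eventually.of_forall fun x => (hpos x).le)] at h2
    rwa [ENNReal.ofReal_eq_one] at h2
  rw [lintegral_gradient_log_sq hK hπ hg hpos,
    klDiv_withDensity_of_isCompact hK hπ hg.continuous hpos, ← ENNReal.ofReal_mul hC.le]
  exact ENNReal.ofReal_le_ofReal (h g hg hpos h1)

/-- A single `C¹` density bounds the log-Sobolev constant from below. -/
theorem le_logSobolevConst {π : Measure E} [IsFiniteMeasure π] {K : Set E}
    (hK : IsCompact K) (hπ : π Kᶜ = 0) {D : ℝ} (hD : 0 ≤ D) {g : E → ℝ} (hg : ContDiff ℝ 1 g)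
    (hpos : ∀ x, 0 < g x) (h1 : ∫ x, g x ∂π = 1)
    (h : D * ∫ x, ‖fderiv ℝ g x‖ ^ 2 / g x ∂π < ∫ x, klFun (g x) ∂π) :
    ENNReal.ofReal D ≤ logSobolevConst π := by
  refine le_sInf fun C hC => ?_
  by_contra! hlt
  have hint := integrable_of_continuous_of_isCompact hK hπ hg.continuous
  have hρ : IsProbabilityMeasure (π.withDensity fun x => ENNReal.ofReal (g x)) := by
    constructor
    rw [withDensity_apply _ MeasurableSet.univ, Measure.restrict_univ,
      ← ofReal_integral_eq_lintegral_ofReal hint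
        (Filter.Eventually.of_forall fun x => (hpos x).le), h1, ENNReal.ofReal_one]
  have hI : 0 ≤ ∫ x, ‖fderiv ℝ g x‖ ^ 2 / g x ∂π :=
    integral_nonneg fun x => div_nonneg (sq_nonneg _) (hpos x).le
  -- One representative bounds the infimum from above, which is the direction needed here.
  have hF : fisherDiv (π.withDensity fun x => ENNReal.ofReal (g x)) π
      ≤ ENNReal.ofReal (∫ x, ‖fderiv ℝ g x‖ ^ 2 / g x ∂π) := by
    rw [← lintegral_gradient_log_sq hK hπ hg hpos]
    exact iInf_le_of_le g (iInf_le_of_le hg (iInf_le_of_le hpos (iInf_le_of_le rfl le_rfl)))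
  have h2 := (hC _ hρ).trans (mul_le_mul' hlt.le hF)
  rw [klDiv_withDensity_of_isCompact hK hπ hg.continuous hpos, ← ENNReal.ofReal_mul hD,
    ENNReal.ofReal_le_ofReal_iff (mul_nonneg hD hI)] at h2
  exact absurd h2 (not_le.2 h)

end General

/-! ### Bounds for `klFun` and the sinusoidal test density -/

theorem klFun_le_sq {x : ℝ} (hx : 0 < x) : klFun x ≤ (x - 1) ^ 2 := by
  rw [klFun_apply]
  nlinarith [mul_le_mul_of_nonneg_left (Real.log_le_sub_one_of_pos hx) hx.le]

/-- This is `log √x ≥ 1 - 1/√x` multiplied by `2x`. Near `1` it loses a factor of two, which the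
final constants can afford. -/
theorem sq_sqrt_sub_one_le_klFun {x : ℝ} (hx : 0 < x) : (√x - 1) ^ 2 ≤ klFun x := by
  have hs : 0 < √x := Real.sqrt_pos.2 hx
  have h1 : Real.log x = 2 * Real.log √x := by rw [Real.log_sqrt hx.le]; ring
  have h2 := mul_le_mul_of_nonneg_left (Real.one_sub_inv_le_log_of_pos hs) hx.le
  have h3 : x * (√x)⁻¹ = √x := by
    rw [← div_eq_mul_inv, Real.div_sqrt]
  rw [klFun_apply, h1]
  nlinarith [Real.sq_sqrt hx.le]

/-- Near `1` the function `klFun` is bounded below by a multiple of the square distance to `1`. -/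
theorem sq_le_klFun_one_add {u : ℝ} (hu : |u| ≤ 1 / 1000) : u ^ 2 ≤ 4.003 * klFun (1 + u) := by
  obtain ⟨h1, h2⟩ := abs_le.1 hu
  have hx : 0 < 1 + u := by linarith
  have h3 := sq_sqrt_sub_one_le_klFun hx
  -- The constant comes from `(1.0005 + 1)² < 4.003`.
  have hs : √(1 + u) ≤ 1.0005 := Real.sqrt_le_iff.2 ⟨by norm_num, by norm_num; linarith⟩
  have hs0 := Real.sqrt_nonneg (1 + u)
  have h4 : u = (√(1 + u) - 1) * (√(1 + u) + 1) := by
    nlinarith [Real.sq_sqrt hx.le]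
  calc u ^ 2 = (√(1 + u) - 1) ^ 2 * (√(1 + u) + 1) ^ 2 := by
        rw [← mul_pow, ← h4]
    _ ≤ (√(1 + u) - 1) ^ 2 * 4.003 := by gcongr; nlinarith
    _ ≤ 4.003 * klFun (1 + u) := by linarith

/-- Lower bound for the log-Sobolev constant from a small sinusoidal perturbation of the density in
the first coordinate. -/
theorem le_logSobolevConst_of_sin {π : Measure Plane} [IsProbabilityMeasure π] {K : Set Plane}
    (hK : IsCompact K) (hπ : π Kᶜ = 0) {D κ : ℝ} (hD : 0 ≤ D)
    (h0 : ∫ x, Real.sin (κ * x 0) ∂π = 0)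
    (h : D * κ ^ 2 * 4.01 * ∫ x, Real.cos (κ * x 0) ^ 2 ∂π < ∫ x, Real.sin (κ * x 0) ^ 2 ∂π) :
    ENNReal.ofReal D ≤ logSobolevConst π := by
  set g : Plane → ℝ := fun x => 1 + 1 / 1000 * Real.sin (κ * x 0) with hgdef
  have hc0 : Continuous fun x : Plane => x 0 := by fun_prop
  have hint : ∀ {F : Plane → ℝ}, Continuous F → Integrable F π :=
    fun hF => integrable_of_continuous_of_isCompact hK hπ hF
  have hu : ∀ x : Plane, |1 / 1000 * Real.sin (κ * x 0)| ≤ 1 / 1000 := fun x => by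
    rw [abs_mul, abs_of_pos (by norm_num : (0 : ℝ) < 1 / 1000)]
    linarith [Real.abs_sin_le_one (κ * x 0)]
  have hlow : ∀ x, 999 / 1000 ≤ g x := fun x => by
    have := (abs_le.1 (hu x)).1
    simp only [hgdef]; linarith
  have hpos : ∀ x, 0 < g x := fun x => by linarith [hlow x]
  have hg : ContDiff ℝ 1 g := by
    have : ContDiff ℝ 1 fun x : Plane => x 0 := by fun_prop
    exact contDiff_const.add (contDiff_const.mul (Real.contDiff_sin.comp (contDiff_const.mul this)))
  have hfd : ∀ x, ‖fderiv ℝ g x‖ ^ 2 ≤ (1 / 1000) ^ 2 * κ ^ 2 * Real.cos (κ * x 0) ^ 2 := fun x => by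
    have hp : HasFDerivAt (fun x : Plane => x 0) (EuclideanSpace.proj (0 : Fin 2) : Plane →L[ℝ] ℝ) x :=
      (EuclideanSpace.proj (0 : Fin 2) : Plane →L[ℝ] ℝ).hasFDerivAt
    have hn : ‖(EuclideanSpace.proj (0 : Fin 2) : Plane →L[ℝ] ℝ)‖ ≤ 1 :=
      ContinuousLinearMap.opNorm_le_bound _ zero_le_one fun v => by
        simpa using PiLp.norm_apply_le v 0
    have hd := (((hp.const_mul κ).sin).const_mul (1 / 1000)).const_add 1
    rw [hd.fderiv, norm_smul, norm_smul, norm_smul, mul_pow, mul_pow, mul_pow,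
      Real.norm_eq_abs, Real.norm_eq_abs, Real.norm_eq_abs, sq_abs, sq_abs, sq_abs]
    have : ‖(EuclideanSpace.proj (0 : Fin 2) : Plane →L[ℝ] ℝ)‖ ^ 2 ≤ 1 :=
      pow_le_one₀ (norm_nonneg _) hn
    have h5 : 0 ≤ (1 / 1000 : ℝ) ^ 2 * κ ^ 2 * Real.cos (κ * x 0) ^ 2 := by positivity
    nlinarith
  have hF : ∫ x, ‖fderiv ℝ g x‖ ^ 2 / g x ∂π
      ≤ (1 / 1000) ^ 2 * κ ^ 2 * (1000 / 999) * ∫ x, Real.cos (κ * x 0) ^ 2 ∂π := by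
    rw [← integral_const_mul]
    refine integral_mono (hint (continuous_fderiv_sq_div hg hpos)) (hint (by fun_prop)) fun x => ?_
    simp only
    rw [div_le_iff₀ (hpos x)]
    have h5 : 0 ≤ (1 / 1000 : ℝ) ^ 2 * κ ^ 2 * Real.cos (κ * x 0) ^ 2 := by positivity
    nlinarith [hfd x, hlow x]
  have hE : (1 / 1000) ^ 2 * ∫ x, Real.sin (κ * x 0) ^ 2 ∂π ≤ 4.003 * ∫ x, klFun (g x) ∂π := by
    rw [← integral_const_mul, ← integral_const_mul]
    refine integral_mono (hint (by fun_prop))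
      (hint (continuous_const.mul (continuous_klFun.comp hg.continuous))) fun x => ?_
    simpa [hgdef, mul_pow] using sq_le_klFun_one_add (hu x)
  refine le_logSobolevConst hK hπ hD hg hpos ?_ ?_
  · simp only [hgdef]
    rw [integral_add (integrable_const _) (hint (by fun_prop)), integral_const_mul, h0]
    simp
  -- The losses `4.003` (entropy) and `1000/999` (lower bound on `g`) multiply to less than `4.01`;
  -- the amplitude cancels.
  · have hcos : 0 ≤ ∫ x, Real.cos (κ * x 0) ^ 2 ∂π := integral_nonneg fun x => sq_nonneg _
    have h6 := mul_le_mul_of_nonneg_left hF hD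
    have h7 : 0 ≤ D * κ ^ 2 * ∫ x, Real.cos (κ * x 0) ^ 2 ∂π := by positivity
    nlinarith

/-! ### Gaussian weight on an interval, by transport -/

/-- Monotone transport between two positive continuous densities of equal mass on an interval. -/
theorem exists_monotone_transport {α β : ℝ} (hαβ : α ≤ β) {p q : ℝ → ℝ} (hp : Continuous p)
    (hq : Continuous q) (hp0 : ∀ x, 0 < p x) (hq0 : ∀ x, 0 < q x)
    (hpq : ∫ x in α..β, p x = ∫ x in α..β, q x) :
    ∃ T : ℝ → ℝ, Continuous T ∧ T α = α ∧ T β = β ∧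
      ∀ x ∈ Set.Icc α β, HasDerivAt T (p x / q (T x)) x := by
  -- Continuing `q` by its endpoint values keeps it bounded below by some `c > 0`, so its primitive
  -- `G` is a bijection of `ℝ`. The transport is `G⁻¹ ∘ F`, which maps `[α, β]` to itself, where `r
  -- = q`.
  set r : ℝ → ℝ := fun x => q (max α (min x β)) with hr
  have hrc : Continuous r := by fun_prop
  have hr0 : ∀ x, 0 < r x := fun x => hq0 _
  have hrq : ∀ x ∈ Set.Icc α β, r x = q x := fun x hx => by
    simp only [hr]; rw [min_eq_left hx.2, max_eq_right hx.1]
  obtain ⟨c, hc, hcr⟩ : ∃ c > 0, ∀ x, c ≤ r x := by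
    obtain ⟨m, -, hm⟩ := isCompact_Icc.exists_isMinOn (Set.nonempty_Icc.2 hαβ) hq.continuousOn
    exact ⟨q m, hq0 m, fun x => hm ⟨le_max_left _ _, max_le hαβ (min_le_right _ _)⟩⟩
  set G : ℝ → ℝ := fun x => ∫ t in α..x, r t with hG
  set F : ℝ → ℝ := fun x => ∫ t in α..x, p t with hF
  have hGd : ∀ x, HasDerivAt G (r x) x := fun x => hrc.integral_hasStrictDerivAt α x |>.hasDerivAt
  have hFd : ∀ x, HasDerivAt F (p x) x := fun x => hp.integral_hasStrictDerivAt α x |>.hasDerivAt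
  have hGm : StrictMono G := strictMono_of_hasDerivAt_pos hGd hr0
  have hFm : StrictMono F := strictMono_of_hasDerivAt_pos hFd hp0
  have hGc : Continuous G := continuous_iff_continuousAt.2 fun x => (hGd x).continuousAt
  have hFc : Continuous F := continuous_iff_continuousAt.2 fun x => (hFd x).continuousAt
  have hGα : G α = 0 := by simp [hG]
  have hFα : F α = 0 := by simp [hF]
  have hFβ : F β = G β := by
    simp only [hF, hG]
    rw [hpq]
    exact intervalIntegral.integral_congr fun x hx => (hrq x (by rwa [Set.uIcc_of_le hαβ] at hx)).symm
  have hlin : Monotone fun x => G x - c * (x - α) := by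
    refine monotone_of_hasDerivAt_nonneg (f' := fun x => r x - c * 1)
      (fun x => (hGd x).sub (((hasDerivAt_id x).sub_const α).const_mul c)) fun x => ?_
    simpa using hcr x
  have hclin : Filter.Tendsto (fun x => c * (x - α)) Filter.atTop Filter.atTop :=
    (Filter.tendsto_atTop_add_const_right _ (-α) Filter.tendsto_id).const_mul_atTop hc
  have hclin' : Filter.Tendsto (fun x => c * (x - α)) Filter.atBot Filter.atBot :=
    (Filter.tendsto_atBot_add_const_right _ (-α) Filter.tendsto_id).const_mul_atBot hc
  have hGs : Function.Surjective G := by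
    refine hGc.surjective ?_ ?_
    · refine Filter.tendsto_atTop_mono' _ ?_ hclin
      filter_upwards [Filter.eventually_ge_atTop α] with x hx
      have := hlin hx
      simp only [hGα, sub_self, mul_zero] at this
      linarith
    · refine Filter.tendsto_atBot_mono' _ ?_ hclin'
      filter_upwards [Filter.eventually_le_atBot α] with x hx
      have := hlin hx
      simp only [hGα, sub_self, mul_zero] at this
      linarith
  set e := hGm.orderIsoOfSurjective G hGs with he
  have hGe : ∀ y, G (e.symm y) = y := fun y => e.apply_symm_apply y
  have heG : ∀ y, e.symm (G y) = y := fun y => e.symm_apply_apply y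
  have hα : e.symm (F α) = α := by rw [hFα, ← hGα, heG]
  have hβ : e.symm (F β) = β := by rw [hFβ, heG]
  refine ⟨fun x => e.symm (F x), e.symm.continuous.comp hFc, hα, hβ, fun x hx => ?_⟩
  have hT : e.symm (F x) ∈ Set.Icc α β :=
    ⟨hα.symm.le.trans (e.symm.monotone (hFm.monotone hx.1)),
      (e.symm.monotone (hFm.monotone hx.2)).trans hβ.le⟩
  have h1 : HasDerivAt e.symm (r (e.symm (F x)))⁻¹ (F x) :=
    HasDerivAt.of_local_left_inverse e.symm.continuous.continuousAt (hGd _) (hr0 _).ne'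
      (Filter.Eventually.of_forall hGe)
  have h2 := h1.comp x (hFd x)
  rw [hrq _ hT] at h2
  rw [div_eq_inv_mul]
  exact h2

/-- The log-Sobolev inequality with the Bakry-Émery constant for the Gaussian weight `exp (-x ^ 2)`
restricted to an interval, by monotone transport. -/
theorem integral_mul_log_mul_exp_neg_sq_le {α β : ℝ} (hαβ : α ≤ β) {h h' : ℝ → ℝ}
    (hd : ∀ x, HasDerivAt h (h' x) x) (hc : Continuous h') (hpos : ∀ x, 0 < h x)
    (hm : ∫ x in α..β, h x * Real.exp (-x ^ 2) = ∫ x in α..β, Real.exp (-x ^ 2)) :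
    ∫ x in α..β, h x * Real.log (h x) * Real.exp (-x ^ 2)
      ≤ 1 / 4 * ∫ x in α..β, h' x ^ 2 / h x * Real.exp (-x ^ 2) := by
  have hhc : Continuous h := continuous_iff_continuousAt.2 fun x => (hd x).continuousAt
  obtain ⟨T, hT, hTα, hTβ, hTd⟩ := exists_monotone_transport hαβ
    (p := fun x => h x * Real.exp (-x ^ 2)) (q := fun x => Real.exp (-x ^ 2)) (by fun_prop)
    (by fun_prop) (fun x => mul_pos (hpos x) (Real.exp_pos _)) (fun x => Real.exp_pos _) hm
  set T' : ℝ → ℝ := fun x => h x * Real.exp (-x ^ 2) / Real.exp (-T x ^ 2) with hT'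
  have hT'c : Continuous T' := by
    have : ∀ x, Real.exp (-T x ^ 2) ≠ 0 := fun x => (Real.exp_pos _).ne'
    fun_prop (disch := assumption)
  have hE : ∀ x, HasDerivAt (fun x : ℝ => Real.exp (-x ^ 2)) (Real.exp (-x ^ 2) * (-(2 * x))) x :=
    fun x => by simpa using ((hasDerivAt_pow 2 x).neg).exp
  -- `Φ` is the derivative of `(T x - x) h x exp (-x²)` on `[α, β]`. It integrates to zero because
  -- `T` fixes both endpoints.
  set Φ : ℝ → ℝ := fun x =>
    ((T' x - 1) * h x + (T x - x) * h' x) * Real.exp (-x ^ 2)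
      + (T x - x) * h x * (Real.exp (-x ^ 2) * (-(2 * x))) with hΦ
  have hΦd : ∀ x ∈ Set.uIcc α β,
      HasDerivAt (fun x => (T x - x) * h x * Real.exp (-x ^ 2)) (Φ x) x := fun x hx => by
    rw [Set.uIcc_of_le hαβ] at hx
    exact (((hTd x hx).sub (hasDerivAt_id x)).mul (hd x)).mul (hE x)
  have hΦc : Continuous Φ := by fun_prop
  have hΦ0 : ∫ x in α..β, Φ x = 0 := by
    rw [intervalIntegral.integral_eq_sub_of_hasDerivAt hΦd (hΦc.intervalIntegrable _ _), hTα, hTβ]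
    simp
  have hlogc : Continuous fun x => Real.log (h x) := hhc.log fun x => (hpos x).ne'
  have hdivc : Continuous fun x => h' x ^ 2 / h x := (hc.pow 2).div hhc fun x => (hpos x).ne'
  have hpt : ∀ x, h x * Real.log (h x) * Real.exp (-x ^ 2)
      ≤ Φ x + 1 / 4 * (h' x ^ 2 / h x * Real.exp (-x ^ 2)) := fun x => by
    have hT'pos : 0 < T' x := div_pos (mul_pos (hpos x) (Real.exp_pos _)) (Real.exp_pos _)
    have h1 : Real.log (h x) = Real.log (T' x) + x ^ 2 - T x ^ 2 := by
      simp only [hT']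
      rw [Real.log_div (mul_pos (hpos x) (Real.exp_pos _)).ne' (Real.exp_pos _).ne',
        Real.log_mul (hpos x).ne' (Real.exp_pos _).ne', Real.log_exp, Real.log_exp]
      ring
    have h2 := Real.log_le_sub_one_of_pos hT'pos
    have h3 : h x * Real.log (h x) ≤ h x * (T' x - 1 + x ^ 2 - T x ^ 2) :=
      mul_le_mul_of_nonneg_left (by linarith) (hpos x).le
    -- Since `x² - T² = -(T - x)² - 2x(T - x)`, the terms left besides `Φ` are `-h (T - x)² - (T -
    -- x) h'`. Completing the square bounds them by `h'² / (4h)`.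
    have h4 : 0 ≤ h x * ((T x - x) + h' x / h x / 2) ^ 2 := mul_nonneg (hpos x).le (sq_nonneg _)
    have h5 : h x * ((T x - x) + h' x / h x / 2) ^ 2
        = h x * (T x - x) ^ 2 + (T x - x) * h' x + 1 / 4 * (h' x ^ 2 / h x) := by
      have := (hpos x).ne'
      field_simp
      ring
    have h6 : h x * Real.log (h x) ≤ ((T' x - 1) * h x + (T x - x) * h' x)
        + (T x - x) * h x * (-(2 * x)) + 1 / 4 * (h' x ^ 2 / h x) := by
      nlinarith
    have h7 := mul_le_mul_of_nonneg_right h6 (Real.exp_pos (-x ^ 2)).le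
    simp only [hΦ]
    linarith
  calc ∫ x in α..β, h x * Real.log (h x) * Real.exp (-x ^ 2)
      ≤ ∫ x in α..β, (Φ x + 1 / 4 * (h' x ^ 2 / h x * Real.exp (-x ^ 2))) := by
        refine intervalIntegral.integral_mono_on hαβ
          (Continuous.intervalIntegrable (by fun_prop) _ _)
          (Continuous.intervalIntegrable (by fun_prop) _ _) fun x _ => hpt x
    _ = 1 / 4 * ∫ x in α..β, h' x ^ 2 / h x * Real.exp (-x ^ 2) := by
        rw [intervalIntegral.integral_add (hΦc.intervalIntegrable _ _)
          (Continuous.intervalIntegrable (by fun_prop) _ _), hΦ0, zero_add,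
          intervalIntegral.integral_const_mul]

/-! ### Arc length and oscillation along a unit-speed line -/

section Line

variable {E : Type*} [NormedAddCommGroup E] [NormedSpace ℝ E] {γ : ℝ → E} {v : E}

theorem isometry_of_eq_add_smul (hv : ‖v‖ = 1) (hγ : ∀ t, γ t = γ 0 + t • v) : Isometry γ := by
  refine Isometry.of_dist_eq fun s t => ?_
  rw [hγ s, hγ t, dist_add_left, dist_eq_norm, ← sub_smul, norm_smul, hv, mul_one, Real.dist_eq,
    Real.norm_eq_abs]

theorem image_Icc_eq_segment (hγ : ∀ t, γ t = γ 0 + t • v) {α β : ℝ} (hαβ : α ≤ β) :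
    γ '' Set.Icc α β = segment ℝ (γ α) (γ β) := by
  have h : γ = (AffineMap.lineMap (γ 0) (γ 0 + v) : ℝ →ᵃ[ℝ] E) := by
    funext t
    rw [hγ t, AffineMap.lineMap_apply]
    simp [add_comm]
  rw [← segment_eq_Icc hαβ]
  conv_lhs => rw [h]
  rw [image_segment, ← h]

variable [MeasurableSpace E] [BorelSpace E]

/-- Arc length on a segment is the image of Lebesgue measure under a unit speed
parametrization. -/
theorem hausdorffMeasure_restrict_segment (hv : ‖v‖ = 1) (hγ : ∀ t, γ t = γ 0 + t • v) {α β : ℝ}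
    (hαβ : α ≤ β) :
    (Measure.hausdorffMeasure 1).restrict (segment ℝ (γ α) (γ β))
      = (volume.restrict (Set.Icc α β)).map γ := by
  have hi := isometry_of_eq_add_smul hv hγ
  have hcl : IsClosed (segment ℝ (γ α) (γ β)) := by
    rw [← image_Icc_eq_segment hγ hαβ]
    exact (isCompact_Icc.image hi.continuous).isClosed
  have hpre : γ ⁻¹' segment ℝ (γ α) (γ β) = Set.Icc α β := by
    rw [← image_Icc_eq_segment hγ hαβ, Set.preimage_image_eq _ hi.injective]
  rw [← hpre, ← Measure.restrict_map hi.continuous.measurable hcl.measurableSet,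
    ← hausdorffMeasure_real, hi.map_hausdorffMeasure (Or.inl zero_le_one),
    Measure.restrict_restrict hcl.measurableSet, Set.inter_eq_left.2]
  rw [← image_Icc_eq_segment hγ hαβ]
  exact Set.image_subset_range _ _

theorem setIntegral_segment (hv : ‖v‖ = 1) (hγ : ∀ t, γ t = γ 0 + t • v) {α β : ℝ}
    (hαβ : α ≤ β) (F : E → ℝ) :
    ∫ x in segment ℝ (γ α) (γ β), F x ∂Measure.hausdorffMeasure 1 = ∫ t in α..β, F (γ t) := by
  have hi := isometry_of_eq_add_smul hv hγ
  rw [hausdorffMeasure_restrict_segment hv hγ hαβ,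
    hi.isClosedEmbedding.measurableEmbedding.integral_map, integral_Icc_eq_integral_Ioc,
    intervalIntegral.integral_of_le hαβ]

omit [MeasurableSpace E] [BorelSpace E] in
theorem hasDerivAt_comp_line {g : E → ℝ} (hg : ContDiff ℝ 1 g) (hγ : ∀ t, γ t = γ 0 + t • v)
    (t : ℝ) : HasDerivAt (fun t => g (γ t)) (fderiv ℝ g (γ t) v) t := by
  have h1 : HasDerivAt γ v t := by
    have h2 : HasDerivAt (fun t : ℝ => γ 0 + t • v) v t := by
      simpa using ((hasDerivAt_id t).smul_const v).const_add (γ 0)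
    exact h2.congr_of_eventuallyEq (Filter.Eventually.of_forall hγ)
  exact (hg.differentiable one_ne_zero (γ t)).hasFDerivAt.comp_hasDerivAt t h1

omit [MeasurableSpace E] [BorelSpace E] in
/-- The oscillation of a `C¹` function on a segment is at most the integral of the norm of its
derivative. -/
theorem abs_sub_le_integral_norm_fderiv (hv : ‖v‖ = 1) (hγ : ∀ t, γ t = γ 0 + t • v) {α β : ℝ}
    (hαβ : α ≤ β) {g : E → ℝ} (hg : ContDiff ℝ 1 g) {x y : E} (hx : x ∈ segment ℝ (γ α) (γ β))
    (hy : y ∈ segment ℝ (γ α) (γ β)) : |g x - g y| ≤ ∫ t in α..β, ‖fderiv ℝ g (γ t)‖ := by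
  have hi := isometry_of_eq_add_smul hv hγ
  have hcont : Continuous fun t => fderiv ℝ g (γ t) :=
    (hg.continuous_fderiv one_ne_zero).comp hi.continuous
  rw [← image_Icc_eq_segment hγ hαβ] at hx hy
  obtain ⟨s, hs, rfl⟩ := hx
  obtain ⟨t, ht, rfl⟩ := hy
  rw [← intervalIntegral.integral_eq_sub_of_hasDerivAt
    (fun u _ => hasDerivAt_comp_line hg hγ u)
    ((hcont.clm_apply continuous_const).intervalIntegrable _ _), ← Real.norm_eq_abs]
  refine (intervalIntegral.norm_integral_le_integral_norm_uIoc).trans ?_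
  rw [intervalIntegral.integral_of_le hαβ]
  refine (setIntegral_mono (hcont.clm_apply continuous_const).norm.integrableOn_uIoc
    hcont.norm.integrableOn_uIoc fun u => ?_).trans ?_
  · simpa [hv] using (fderiv ℝ g (γ u)).le_opNorm v
  · refine setIntegral_mono_set (hcont.norm.integrableOn_Ioc)
      (Filter.Eventually.of_forall fun _ => norm_nonneg _) (LE.le.eventuallyLE ?_)
    exact Set.Ioc_subset_Ioc (le_min ht.1 hs.1) (max_le ht.2 hs.2)

end Line

/-! ### Uniform and tilted measures; the diameter bound -/

section Uniform

variable {s : Set Plane}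

theorem isProbabilityMeasure_uniformMeasure (h0 : Measure.hausdorffMeasure 1 s ≠ 0)
    (htop : Measure.hausdorffMeasure 1 s ≠ ∞) : IsProbabilityMeasure (uniformMeasure s) :=
  ProbabilityTheory.cond_isProbabilityMeasure_of_finite h0 htop

theorem uniformMeasure_compl (hs : MeasurableSet s) : uniformMeasure s sᶜ = 0 := by
  simp [uniformMeasure, ProbabilityTheory.cond_apply hs]

theorem integral_uniformMeasure (F : Plane → ℝ) :
    ∫ x, F x ∂uniformMeasure s = (∫ x in s, F x ∂Measure.hausdorffMeasure 1)
      / (Measure.hausdorffMeasure 1).real s := by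
  rw [uniformMeasure, ProbabilityTheory.cond, integral_smul_measure, ENNReal.toReal_inv,
    smul_eq_mul, div_eq_inv_mul, measureReal_def]

theorem integral_tilt_uniformMeasure (h0 : (Measure.hausdorffMeasure 1).real s ≠ 0)
    (F R : Plane → ℝ) :
    ∫ x, F x ∂tilt (uniformMeasure s) R
      = (∫ x in s, F x * Real.exp (-R x) ∂Measure.hausdorffMeasure 1)
        / ∫ x in s, Real.exp (-R x) ∂Measure.hausdorffMeasure 1 := by
  rw [tilt, integral_tilted, integral_uniformMeasure, integral_uniformMeasure]
  simp only [smul_eq_mul]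
  have : ∀ c : ℝ, (∫ x in s, Real.exp (-R x) / c * F x ∂Measure.hausdorffMeasure 1)
      = (∫ x in s, F x * Real.exp (-R x) ∂Measure.hausdorffMeasure 1) / c := fun c => by
    rw [← integral_div]
    congr 1
    funext x
    ring
  rw [this]
  field_simp

theorem tilt_compl (hs : MeasurableSet s) (R : Plane → ℝ) : tilt (uniformMeasure s) R sᶜ = 0 :=
  tilted_absolutelyContinuous _ _ (uniformMeasure_compl hs)

theorem isProbabilityMeasure_tilt (hs : IsCompact s) (h0 : Measure.hausdorffMeasure 1 s ≠ 0)
    (htop : Measure.hausdorffMeasure 1 s ≠ ∞) {R : Plane → ℝ} (hR : Continuous R) :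
    IsProbabilityMeasure (tilt (uniformMeasure s) R) := by
  have := isProbabilityMeasure_uniformMeasure h0 htop
  exact isProbabilityMeasure_tilted
    (integrable_of_continuous_of_isCompact hs (uniformMeasure_compl hs.measurableSet)
      (Real.continuous_exp.comp hR.neg))

/-- A uniform measure on a set of diameter `T`, in the sense that the oscillation of each `C¹`
function is at most `T` times its mean gradient norm, has log-Sobolev constant at most `T ^ 2`. -/
theorem logSobolevConst_le_sq {E : Type*} [NormedAddCommGroup E] [InnerProductSpace ℝ E]
    [CompleteSpace E] [MeasurableSpace E] [BorelSpace E] [SecondCountableTopology E]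
    {π : Measure E} [IsProbabilityMeasure π] {K : Set E} (hK : IsCompact K) (hπ : π Kᶜ = 0)
    {T : ℝ} (hT : 0 < T) (h : ∀ g : E → ℝ, ContDiff ℝ 1 g → ∀ x ∈ K, ∀ y ∈ K,
      |g x - g y| ≤ T * ∫ z, ‖fderiv ℝ g z‖ ∂π) :
    logSobolevConst π ≤ ENNReal.ofReal (T ^ 2) := by
  refine logSobolevConst_le hK hπ (by positivity) fun g hg hpos h1 => ?_
  have hint : ∀ {F : E → ℝ}, Continuous F → Integrable F π :=
    fun hF => integrable_of_continuous_of_isCompact hK hπ hF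
  have hae : ∀ᵐ x ∂π, x ∈ K := by rw [ae_iff]; exact hπ
  have hgc := hg.continuous
  have hfc : Continuous fun x => ‖fderiv ℝ g x‖ := (hg.continuous_fderiv one_ne_zero).norm
  set m := ∫ z, ‖fderiv ℝ g z‖ ∂π with hm
  have hm0 : 0 ≤ m := integral_nonneg fun _ => norm_nonneg _
  have hosc : ∀ x ∈ K, |g x - 1| ≤ T * m := fun x hx => by
    have h2 : g x - 1 = ∫ y, (g x - g y) ∂π := by
      rw [integral_sub (integrable_const _) (hint hgc), h1]
      simp
    rw [h2, ← Real.norm_eq_abs]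
    refine (norm_integral_le_of_norm_le_const (C := T * m) ?_).trans (by simp)
    filter_upwards [hae] with y hy using h g hg x hx y hy
  -- Cauchy-Schwarz with `∫ g = 1`, in the linearized form `2m‖∇g‖ - m² g ≤ ‖∇g‖² / g`.
  have hm2 : m ^ 2 ≤ ∫ x, ‖fderiv ℝ g x‖ ^ 2 / g x ∂π := by
    have h3 : ∫ x, (2 * m * ‖fderiv ℝ g x‖ - m ^ 2 * g x) ∂π
        ≤ ∫ x, ‖fderiv ℝ g x‖ ^ 2 / g x ∂π := by
      refine integral_mono (hint (by fun_prop)) (hint (continuous_fderiv_sq_div hg hpos)) fun x => ?_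
      simp only
      rw [le_div_iff₀ (hpos x)]
      nlinarith [sq_nonneg (‖fderiv ℝ g x‖ - m * g x)]
    rw [integral_sub (hint (by fun_prop)) (hint (by fun_prop)), integral_const_mul,
      integral_const_mul, h1, ← hm] at h3
    linarith
  calc ∫ x, InformationTheory.klFun (g x) ∂π ≤ ∫ _, (T * m) ^ 2 ∂π := by
        refine integral_mono_ae (hint (InformationTheory.continuous_klFun.comp hgc))
          (integrable_const _) ?_
        filter_upwards [hae] with x hx
        refine (klFun_le_sq (hpos x)).trans ?_
        exact sq_le_sq.2 ((hosc x hx).trans (le_abs_self _))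
    _ = T ^ 2 * m ^ 2 := by simp [mul_pow]
    _ ≤ _ := by gcongr

end Uniform

open Real

theorem vertical_eq (c t : ℝ) : (!₂[c, t] : Plane) = !₂[c, 0] + t • !₂[0, 1] := by
  ext i; fin_cases i <;> simp

theorem horizontal_eq (c t : ℝ) : (!₂[t, c] : Plane) = !₂[0, c] + t • !₂[1, 0] := by
  ext i; fin_cases i <;> simp

theorem norm_vertical : ‖(!₂[0, 1] : Plane)‖ = 1 := by simp [EuclideanSpace.norm_eq]

theorem norm_horizontal : ‖(!₂[1, 0] : Plane)‖ = 1 := by simp [EuclideanSpace.norm_eq]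

theorem norm_sq_pair (x y : ℝ) : ‖(!₂[x, y] : Plane)‖ ^ 2 = x ^ 2 + y ^ 2 := by
  simp [EuclideanSpace.norm_sq_eq]

theorem isCompact_segment {E : Type*} [NormedAddCommGroup E] [NormedSpace ℝ E] (x y : E) :
    IsCompact (segment ℝ x y) := by
  rw [segment_eq_image_lineMap]
  exact isCompact_Icc.image (AffineMap.lineMap_continuous)

/-! ### The horizontal segment, before and after the tilt -/

section Segment

variable {L : ℝ}

theorem setIntegral_horizontal {α β : ℝ} (hαβ : α ≤ β) (c : ℝ) (F : Plane → ℝ) :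
    ∫ x in segment ℝ !₂[α, c] !₂[β, c], F x ∂Measure.hausdorffMeasure 1
      = ∫ t in α..β, F !₂[t, c] :=
  setIntegral_segment (γ := fun t => !₂[t, c]) norm_horizontal (horizontal_eq c) hαβ F

theorem setIntegral_vertical {α β : ℝ} (hαβ : α ≤ β) (c : ℝ) (F : Plane → ℝ) :
    ∫ x in segment ℝ !₂[c, α] !₂[c, β], F x ∂Measure.hausdorffMeasure 1
      = ∫ t in α..β, F !₂[c, t] :=
  setIntegral_segment (γ := fun t => !₂[c, t]) norm_vertical (vertical_eq c) hαβ F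

theorem hausdorffMeasure_horizontal {α β : ℝ} (hαβ : α ≤ β) (c : ℝ) :
    Measure.hausdorffMeasure 1 (segment ℝ (!₂[α, c] : Plane) !₂[β, c])
      = ENNReal.ofReal (β - α) := by
  rw [hausdorffMeasure_segment, edist_dist]
  congr 1
  rw [(isometry_of_eq_add_smul (γ := fun t => (!₂[t, c] : Plane)) norm_horizontal
    (horizontal_eq c)).dist_eq α β, dist_comm, Real.dist_eq, abs_of_nonneg (sub_nonneg.2 hαβ)]

theorem hausdorffMeasure_vertical {α β : ℝ} (hαβ : α ≤ β) (c : ℝ) :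
    Measure.hausdorffMeasure 1 (segment ℝ (!₂[c, α] : Plane) !₂[c, β])
      = ENNReal.ofReal (β - α) := by
  rw [hausdorffMeasure_segment, edist_dist]
  congr 1
  rw [(isometry_of_eq_add_smul (γ := fun t => (!₂[c, t] : Plane)) norm_vertical
    (vertical_eq c)).dist_eq α β, dist_comm, Real.dist_eq, abs_of_nonneg (sub_nonneg.2 hαβ)]

theorem integral_eq_zero_of_odd {f : ℝ → ℝ} (hf : ∀ x, f (-x) = -f x) (a : ℝ) :
    ∫ x in -a..a, f x = 0 := by
  have h := intervalIntegral.integral_comp_neg (a := -a) (b := a) f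
  simp only [hf, neg_neg, intervalIntegral.integral_neg] at h
  linarith

theorem le_logSobolevConst_uniform_segment (hL : 0 < L) :
    ENNReal.ofReal (0.101 * L ^ 2)
      ≤ logSobolevConst (uniformMeasure (segment ℝ !₂[-L, 0] !₂[L, 0])) := by
  have hLL : -L ≤ L := by linarith
  set s : Set Plane := segment ℝ !₂[-L, 0] !₂[L, 0] with hs
  have hμ : Measure.hausdorffMeasure 1 s = ENNReal.ofReal (L - -L) :=
    hausdorffMeasure_horizontal hLL 0
  have hr : (Measure.hausdorffMeasure 1).real s = 2 * L := by
    rw [measureReal_def, hμ, ENNReal.toReal_ofReal (by linarith)]; ring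
  have hcpt : IsCompact s := isCompact_segment _ _
  have hprob := isProbabilityMeasure_uniformMeasure (s := s) (by rw [hμ]; simpa using by linarith)
    (by rw [hμ]; exact ENNReal.ofReal_ne_top)
  have hnull := uniformMeasure_compl hcpt.measurableSet
  have hcos : ∫ x, cos (π / (2 * L) * x 0) ^ 2 ∂uniformMeasure s = 1 / 2 := by
    rw [integral_uniformMeasure, hr, hs, setIntegral_horizontal hLL]
    have h1 := intervalIntegral.integral_comp_mul_left (a := -L) (b := L) (fun x => cos x ^ 2)
      (c := π / (2 * L)) (by positivity)
    have h2 : π / (2 * L) * L = π / 2 := by field_simp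
    simp only [mul_neg, h2, integral_cos_sq, cos_neg, cos_pi_div_two, smul_eq_mul] at h1
    simp only [Matrix.cons_val_zero, h1]
    field_simp
    ring
  have hsin : ∫ x, sin (π / (2 * L) * x 0) ^ 2 ∂uniformMeasure s = 1 / 2 := by
    simp only [sin_sq]
    rw [integral_sub (integrable_const _)
      (integrable_of_continuous_of_isCompact hcpt hnull (by fun_prop)), hcos]
    simp
    norm_num
  refine le_logSobolevConst_of_sin hcpt hnull (κ := π / (2 * L)) (by positivity) ?_ ?_
  · rw [integral_uniformMeasure, hs, setIntegral_horizontal hLL]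
    simp only [Matrix.cons_val_zero]
    rw [integral_eq_zero_of_odd (fun x => by rw [mul_neg, sin_neg]), zero_div]
  · rw [hcos, hsin]
    -- `0.101` is admissible because `0.101 · 4.01 · π² / 4 < 1`, by a narrow margin.
    have : 0.101 * L ^ 2 * (π / (2 * L)) ^ 2 = 0.101 / 4 * π ^ 2 := by field_simp; norm_num
    rw [this]
    nlinarith [pi_lt_d4, pi_pos]

theorem logSobolevConst_tilt_segment_le (hL : 0 < L) :
    logSobolevConst (tilt (uniformMeasure (segment ℝ !₂[-L, 0] !₂[L, 0])) fun x => ‖x‖ ^ 2)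
      ≤ ENNReal.ofReal (1 / 4) := by
  have hLL : -L ≤ L := by linarith
  set s : Set Plane := segment ℝ !₂[-L, 0] !₂[L, 0] with hs
  have hμ : Measure.hausdorffMeasure 1 s = ENNReal.ofReal (L - -L) :=
    hausdorffMeasure_horizontal hLL 0
  have hr : (Measure.hausdorffMeasure 1).real s ≠ 0 := by
    rw [measureReal_def, hμ, ENNReal.toReal_ofReal (by linarith)]; linarith
  have hcpt : IsCompact s := isCompact_segment _ _
  have hprob := isProbabilityMeasure_tilt (s := s) hcpt (by rw [hμ]; simpa using by linarith)
    (by rw [hμ]; exact ENNReal.ofReal_ne_top) (R := fun x => ‖x‖ ^ 2) (by fun_prop)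
  have hnull := tilt_compl hcpt.measurableSet fun x => ‖x‖ ^ 2
  set Z := ∫ t in -L..L, exp (-t ^ 2) with hZ
  have hZ0 : 0 < Z := intervalIntegral.intervalIntegral_pos_of_pos
    (Continuous.intervalIntegrable (by fun_prop) _ _) (fun x => exp_pos _) (by linarith)
  have hI : ∀ F : Plane → ℝ, ∫ x, F x ∂tilt (uniformMeasure s) (fun x => ‖x‖ ^ 2)
      = (∫ t in -L..L, F !₂[t, 0] * exp (-t ^ 2)) / Z := fun F => by
    rw [integral_tilt_uniformMeasure hr, hs, setIntegral_horizontal hLL,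
      setIntegral_horizontal hLL]
    simp only [norm_sq_pair, ne_eq, OfNat.ofNat_ne_zero, not_false_eq_true, zero_pow, add_zero, hZ]
  refine logSobolevConst_le hcpt hnull (by norm_num) fun g hg hpos h1 => ?_
  have hd := hasDerivAt_comp_line (γ := fun t => !₂[t, 0]) hg (horizontal_eq 0)
  have hγ : Continuous fun t : ℝ => (!₂[t, 0] : Plane) :=
    (isometry_of_eq_add_smul (γ := fun t => (!₂[t, 0] : Plane)) norm_horizontal
      (horizontal_eq 0)).continuous
  have hgc : Continuous fun t => g !₂[t, 0] := hg.continuous.comp hγ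
  have hfc : Continuous fun t => fderiv ℝ g !₂[t, 0] :=
    (hg.continuous_fderiv one_ne_zero).comp hγ
  have hdc : Continuous fun t => fderiv ℝ g !₂[t, 0] !₂[1, 0] := hfc.clm_apply continuous_const
  rw [hI, div_eq_one_iff_eq hZ0.ne'] at h1
  have hlog : Continuous fun t => log (g !₂[t, 0]) := hgc.log fun t => (hpos _).ne'
  have key := integral_mul_log_mul_exp_neg_sq_le hLL hd hdc (fun t => hpos _) h1
  rw [hI, hI, ← mul_div_assoc, div_le_div_iff_of_pos_right hZ0]
  calc ∫ t in -L..L, InformationTheory.klFun (g !₂[t, 0]) * exp (-t ^ 2)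
      = ∫ t in -L..L, (g !₂[t, 0] * log (g !₂[t, 0]) * exp (-t ^ 2)
          + (exp (-t ^ 2) - g !₂[t, 0] * exp (-t ^ 2))) := by
        refine intervalIntegral.integral_congr fun t _ => ?_
        simp only [InformationTheory.klFun_apply]
        ring
    _ = ∫ t in -L..L, g !₂[t, 0] * log (g !₂[t, 0]) * exp (-t ^ 2) := by
        rw [intervalIntegral.integral_add (Continuous.intervalIntegrable (by fun_prop) _ _)
          (Continuous.intervalIntegrable (by fun_prop) _ _),
          intervalIntegral.integral_sub (Continuous.intervalIntegrable (by fun_prop) _ _)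
          (Continuous.intervalIntegrable (by fun_prop) _ _), h1, sub_self, add_zero]
    _ ≤ _ := key
    _ ≤ _ := by
        have hdiv1 : Continuous fun t => fderiv ℝ g !₂[t, 0] !₂[1, 0] ^ 2 / g !₂[t, 0] :=
          (hdc.pow 2).div hgc fun t => (hpos _).ne'
        have hdiv2 : Continuous fun t => ‖fderiv ℝ g !₂[t, 0]‖ ^ 2 / g !₂[t, 0] :=
          (hfc.norm.pow 2).div hgc fun t => (hpos _).ne'
        refine mul_le_mul_of_nonneg_left (intervalIntegral.integral_mono_on hLL
          (Continuous.intervalIntegrable (by fun_prop) _ _)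
          (Continuous.intervalIntegrable (by fun_prop) _ _) fun t _ => ?_) (by norm_num)
        -- The transport inequality involves only the tangential derivative, which the full gradient
        -- dominates.
        have h2 : |fderiv ℝ g !₂[t, 0] !₂[1, 0]| ≤ ‖fderiv ℝ g !₂[t, 0]‖ := by
          simpa [norm_horizontal] using (fderiv ℝ g !₂[t, 0]).le_opNorm !₂[1, 0]
        have h3 := (hpos !₂[t, 0]).le
        have h4 : fderiv ℝ g !₂[t, 0] !₂[1, 0] ^ 2 ≤ ‖fderiv ℝ g !₂[t, 0]‖ ^ 2 :=
          sq_le_sq.2 (h2.trans (le_abs_self _))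
        gcongr

end Segment

/-! ### The bridge, before and after the tilt -/

section Bridge

variable {w a b : ℝ}

theorem isCompact_bridge : IsCompact (bridge w a b) :=
  ((isCompact_segment _ _).union (isCompact_segment _ _)).union (isCompact_segment _ _)

/-- The bars overlap only at the two corners, which have zero length; `0 < w` keeps the legs apart.
-/
theorem hausdorffMeasure_restrict_bridge (hw : 0 < w) (hab : a ≤ b) :
    (Measure.hausdorffMeasure 1).restrict (bridge w a b)
      = (Measure.hausdorffMeasure 1).restrict (segment ℝ (!₂[-w, a] : Plane) !₂[-w, b])
        + (Measure.hausdorffMeasure 1).restrict (segment ℝ (!₂[-w, b] : Plane) !₂[w, b])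
        + (Measure.hausdorffMeasure 1).restrict (segment ℝ (!₂[w, a] : Plane) !₂[w, b]) := by
  have hv : ∀ c : ℝ, (fun t => (!₂[c, t] : Plane)) '' Set.Icc a b
      = segment ℝ (!₂[c, a] : Plane) !₂[c, b] := fun c =>
    image_Icc_eq_segment (γ := fun t => (!₂[c, t] : Plane)) (vertical_eq c) hab
  have hh : (fun t => (!₂[t, b] : Plane)) '' Set.Icc (-w) w
      = segment ℝ (!₂[-w, b] : Plane) !₂[w, b] :=
    image_Icc_eq_segment (γ := fun t => (!₂[t, b] : Plane)) (horizontal_eq b) (by linarith)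
  have hna := MeasureTheory.Measure.nullSingletonClass_hausdorff Plane (d := 1) one_pos
  rw [bridge, Measure.restrict_union₀ _ (isCompact_segment _ _).measurableSet.nullMeasurableSet,
    Measure.restrict_union₀ _ (isCompact_segment _ _).measurableSet.nullMeasurableSet]
  · refine measure_mono_null (t := {!₂[-w, b]}) ?_ (measure_singleton _)
    rw [← hv, ← hh]
    rintro _ ⟨⟨t, -, rfl⟩, ⟨u, -, hu⟩⟩
    have h0 := congrArg (fun x : Plane => x 1) hu
    simp at h0
    simp [h0]
  · refine measure_mono_null (t := {!₂[w, b]}) ?_ (measure_singleton _)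
    rw [← hv, ← hv, ← hh]
    rintro _ ⟨⟨t, -, rfl⟩ | ⟨t, -, rfl⟩, ⟨u, -, hu⟩⟩
    · have h0 := congrArg (fun x : Plane => x 0) hu
      simp at h0
      linarith
    · have h0 := congrArg (fun x : Plane => x 0) hu
      simp at h0
      simp [h0]

theorem hausdorffMeasure_bridge (hw : 0 < w) (hab : a ≤ b) :
    Measure.hausdorffMeasure 1 (bridge w a b) = ENNReal.ofReal (2 * w + 2 * (b - a)) := by
  rw [← Measure.restrict_apply_univ, hausdorffMeasure_restrict_bridge hw hab, Measure.add_apply,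
    Measure.add_apply, Measure.restrict_apply_univ, Measure.restrict_apply_univ,
    Measure.restrict_apply_univ, hausdorffMeasure_vertical hab, hausdorffMeasure_vertical hab,
    hausdorffMeasure_horizontal (by linarith), ← ENNReal.ofReal_add (by linarith) (by linarith),
    ← ENNReal.ofReal_add (by linarith) (by linarith)]
  congr 1
  ring

theorem setIntegral_bridge (hw : 0 < w) (hab : a ≤ b) {F : Plane → ℝ} (hF : Continuous F) :
    ∫ x in bridge w a b, F x ∂Measure.hausdorffMeasure 1
      = (∫ t in a..b, F !₂[-w, t]) + (∫ t in -w..w, F !₂[t, b]) + ∫ t in a..b, F !₂[w, t] := by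
  have hint : ∀ x y : Plane,
      Integrable F ((Measure.hausdorffMeasure 1).restrict (segment ℝ x y)) :=
    fun x y => by
      have : IsFiniteMeasure ((Measure.hausdorffMeasure 1).restrict (segment ℝ x y)) :=
        ⟨by rw [Measure.restrict_apply_univ, hausdorffMeasure_segment]; exact edist_lt_top _ _⟩
      refine integrable_of_continuous_of_isCompact (isCompact_segment x y) ?_ hF
      rw [Measure.restrict_apply (isCompact_segment x y).measurableSet.compl]
      simp
  rw [hausdorffMeasure_restrict_bridge hw hab,
    integral_add_measure ((hint _ _).add_measure (hint _ _)) (hint _ _),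
    integral_add_measure (hint _ _) (hint _ _), setIntegral_vertical hab, setIntegral_vertical hab,
    setIntegral_horizontal (by linarith)]

theorem logSobolevConst_uniform_bridge_le (hw : 0 < w) (hab : a ≤ b) :
    logSobolevConst (uniformMeasure (bridge w a b))
      ≤ ENNReal.ofReal ((2 * w + 2 * (b - a)) ^ 2) := by
  have hT : 0 < 2 * w + 2 * (b - a) := by linarith
  have hμ := hausdorffMeasure_bridge hw hab
  have hr : (Measure.hausdorffMeasure 1).real (bridge w a b) = 2 * w + 2 * (b - a) := by
    rw [measureReal_def, hμ, ENNReal.toReal_ofReal hT.le]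
  have hprob := isProbabilityMeasure_uniformMeasure (s := bridge w a b)
    (by rw [hμ]; simpa using hT) (by rw [hμ]; exact ENNReal.ofReal_ne_top)
  refine logSobolevConst_le_sq isCompact_bridge
    (uniformMeasure_compl isCompact_bridge.measurableSet) hT fun g hg => ?_
  rw [integral_uniformMeasure, hr, mul_div_cancel₀ _ hT.ne',
    setIntegral_bridge hw hab (hg.continuous_fderiv one_ne_zero).norm]
  have H1 := fun x hx y hy => abs_le.1 (abs_sub_le_integral_norm_fderiv
    (γ := fun t => (!₂[-w, t] : Plane)) norm_vertical (vertical_eq (-w)) hab hg (x := x) (y := y)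
    hx hy)
  have H2 := fun x hx y hy => abs_le.1 (abs_sub_le_integral_norm_fderiv
    (γ := fun t => (!₂[t, b] : Plane)) norm_horizontal (horizontal_eq b)
    (by linarith : -w ≤ w) hg (x := x) (y := y) hx hy)
  have H3 := fun x hx y hy => abs_le.1 (abs_sub_le_integral_norm_fderiv
    (γ := fun t => (!₂[w, t] : Plane)) norm_vertical (vertical_eq w) hab hg (x := x) (y := y)
    hx hy)
  set A1 := ∫ t in a..b, ‖fderiv ℝ g !₂[-w, t]‖
  set A2 := ∫ t in -w..w, ‖fderiv ℝ g !₂[t, b]‖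
  set A3 := ∫ t in a..b, ‖fderiv ℝ g !₂[w, t]‖
  have c1 := right_mem_segment ℝ (!₂[-w, a] : Plane) !₂[-w, b]
  have c2 := left_mem_segment ℝ (!₂[-w, b] : Plane) !₂[w, b]
  have c3 := right_mem_segment ℝ (!₂[-w, b] : Plane) !₂[w, b]
  have c4 := right_mem_segment ℝ (!₂[w, a] : Plane) !₂[w, b]
  -- Equal endpoints give `0 ≤ A1`, and likewise for `A2` and `A3`; `p4` crosses the whole bar. In
  -- each case below two points are joined through the corners.
  have p1 := H1 _ c1 _ c1
  have p2 := H2 _ c2 _ c2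
  have p3 := H3 _ c4 _ c4
  have p4 := H2 _ c2 _ c3
  rintro x ((hx | hx) | hx) y ((hy | hy) | hy) <;> rw [abs_le]
  · have := H1 x hx y hy; constructor <;> linarith
  · have := H1 x hx _ c1; have := H2 _ c2 y hy; constructor <;> linarith
  · have := H1 x hx _ c1; have := H3 _ c4 y hy; constructor <;> linarith
  · have := H2 x hx _ c2; have := H1 _ c1 y hy; constructor <;> linarith
  · have := H2 x hx y hy; constructor <;> linarith
  · have := H2 x hx _ c3; have := H3 _ c4 y hy; constructor <;> linarith
  · have := H3 x hx _ c4; have := H1 _ c1 y hy; constructor <;> linarith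
  · have := H3 x hx _ c4; have := H2 _ c3 y hy; constructor <;> linarith
  · have := H3 x hx y hy; constructor <;> linarith

/-- The right side of `h` is `(a + w)² - (w² + (a + w/2)²)`: the gap in `‖x‖²` between the lowest
point of the bar and the midpoint of a leg. -/
theorem le_logSobolevConst_tilt_bridge {D : ℝ} (hw : 0 < w) (ha : 0 ≤ a) (hD : 0 ≤ D)
    (h : 4 * (D * (π / (2 * w)) ^ 2 * 4.01 + 1) ≤ a * w - w ^ 2 / 4) :
    ENNReal.ofReal D
      ≤ logSobolevConst (tilt (uniformMeasure (bridge w a (a + w))) fun x => ‖x‖ ^ 2) := by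
  have hab : a ≤ a + w := by linarith
  set s := bridge w a (a + w) with hs
  have hμ := hausdorffMeasure_bridge hw hab
  have hT : 0 < 2 * w + 2 * (a + w - a) := by linarith
  have hcpt : IsCompact s := isCompact_bridge
  have hr : (Measure.hausdorffMeasure 1).real s ≠ 0 := by
    rw [measureReal_def, hμ, ENNReal.toReal_ofReal hT.le]; exact hT.ne'
  have hprob := isProbabilityMeasure_tilt (s := s) hcpt (by rw [hμ]; simpa using hT)
    (by rw [hμ]; exact ENNReal.ofReal_ne_top) (R := fun x => ‖x‖ ^ 2) (by fun_prop)
  have hnull := tilt_compl hcpt.measurableSet fun x => ‖x‖ ^ 2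
  have hκ : π / (2 * w) * w = π / 2 := by field_simp
  set κ := π / (2 * w) with hκdef
  set Z := ∫ x in s, exp (-‖x‖ ^ 2) ∂Measure.hausdorffMeasure 1 with hZ
  set M := D * κ ^ 2 * 4.01 + 1 with hM
  have hM1 : 1 ≤ M := by
    have : 0 ≤ D * κ ^ 2 := by positivity
    linarith
  -- Only the lower half of the right leg is kept, with its weight bounded by the value at that
  -- half's top.
  have hZlow : w / 2 * exp (-(w ^ 2 + (a + w / 2) ^ 2)) ≤ Z := by
    have hint : ∀ c α β : ℝ, IntervalIntegrable (fun t => exp (-(c ^ 2 + t ^ 2))) volume α β :=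
      fun c α β => Continuous.intervalIntegrable (by fun_prop) _ _
    have h1 : 0 ≤ ∫ t in a..a + w, exp (-((-w) ^ 2 + t ^ 2)) :=
      intervalIntegral.integral_nonneg hab fun t _ => (exp_pos _).le
    have h2 : 0 ≤ ∫ t in -w..w, exp (-(t ^ 2 + (a + w) ^ 2)) :=
      intervalIntegral.integral_nonneg (by linarith) fun t _ => (exp_pos _).le
    have h3 : 0 ≤ ∫ t in a + w / 2..a + w, exp (-(w ^ 2 + t ^ 2)) :=
      intervalIntegral.integral_nonneg (by linarith) fun t _ => (exp_pos _).le
    have h4 : ∫ _ in a..a + w / 2, exp (-(w ^ 2 + (a + w / 2) ^ 2))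
        ≤ ∫ t in a..a + w / 2, exp (-(w ^ 2 + t ^ 2)) := by
      refine intervalIntegral.integral_mono_on (by linarith) (by simp) (hint _ _ _) fun t ht => ?_
      refine exp_le_exp.2 ?_
      have := pow_le_pow_left₀ (ha.trans ht.1) ht.2 2
      linarith
    rw [intervalIntegral.integral_const, smul_eq_mul, add_sub_cancel_left] at h4
    rw [hZ, hs, setIntegral_bridge hw hab (by fun_prop)]
    simp only [norm_sq_pair]
    rw [← intervalIntegral.integral_add_adjacent_intervals (hint w a (a + w / 2)) (hint w _ _)]
    linarith
  have hZ0 : 0 < Z := lt_of_lt_of_le (by positivity) hZlow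
  have hcos : (∫ x, cos (κ * x 0) ^ 2 ∂tilt (uniformMeasure s) fun x => ‖x‖ ^ 2)
      ≤ 2 * w * exp (-(a + w) ^ 2) / Z := by
    rw [integral_tilt_uniformMeasure hr, ← hZ]
    gcongr
    rw [hs, setIntegral_bridge hw hab (by fun_prop)]
    -- On the legs `κ x₀ = ±π/2`, so the cosine vanishes and only the bar contributes.
    simp only [norm_sq_pair, Matrix.cons_val_zero, mul_neg, cos_neg, hκ,
      cos_pi_div_two]
    simp only [ne_eq, OfNat.ofNat_ne_zero, not_false_eq_true, zero_pow, zero_mul,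
      intervalIntegral.integral_zero, zero_add, add_zero]
    calc ∫ t in -w..w, cos (κ * t) ^ 2 * exp (-(t ^ 2 + (a + w) ^ 2))
        ≤ ∫ _ in -w..w, exp (-(a + w) ^ 2) := by
          refine intervalIntegral.integral_mono_on (by linarith)
            (Continuous.intervalIntegrable (by fun_prop) _ _) (by simp) fun t _ => ?_
          have h1 : exp (-(t ^ 2 + (a + w) ^ 2)) ≤ exp (-(a + w) ^ 2) :=
            exp_le_exp.2 (by nlinarith)
          have h2 : 0 < exp (-(t ^ 2 + (a + w) ^ 2)) := exp_pos _
          nlinarith [cos_sq_le_one (κ * t)]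
      _ = 2 * w * exp (-(a + w) ^ 2) := by
          rw [intervalIntegral.integral_const, smul_eq_mul]; ring
  have hsin : (∫ x, sin (κ * x 0) ^ 2 ∂tilt (uniformMeasure s) fun x => ‖x‖ ^ 2)
      = 1 - ∫ x, cos (κ * x 0) ^ 2 ∂tilt (uniformMeasure s) fun x => ‖x‖ ^ 2 := by
    simp only [sin_sq]
    rw [integral_sub (integrable_const _)
      (integrable_of_continuous_of_isCompact hcpt hnull (by fun_prop))]
    simp
  refine le_logSobolevConst_of_sin hcpt hnull (κ := κ) hD ?_ ?_
  · rw [integral_tilt_uniformMeasure hr, hs, setIntegral_bridge hw hab (by fun_prop)]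
    simp only [norm_sq_pair, Matrix.cons_val_zero, mul_neg, sin_neg, hκ,
      sin_pi_div_two]
    rw [integral_eq_zero_of_odd (fun x => by rw [mul_neg, sin_neg, neg_sq]; ring)]
    simp
  · rw [hsin]
    -- As `∫ sin² = 1 - ∫ cos²`, the goal is `M ∫ cos² < 1`. It reduces to `4M < exp (a w - w²/4)`,
    -- which follows from `h` and `y < exp y`.
    have hlt : M * (2 * w * exp (-(a + w) ^ 2) / Z) < 1 := by
      rw [← mul_div_assoc, div_lt_one hZ0]
      refine lt_of_lt_of_le ?_ hZlow
      have h1 : 4 * M < exp (4 * M) := by linarith [add_one_le_exp (4 * M)]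
      have h2 : exp (4 * M) * exp (-(a + w) ^ 2) ≤ exp (-(w ^ 2 + (a + w / 2) ^ 2)) := by
        rw [← exp_add]
        exact exp_le_exp.2 (by nlinarith)
      have h3 := mul_lt_mul_of_pos_right h1 (exp_pos (-(a + w) ^ 2))
      have h4 := mul_lt_mul_of_pos_left (h3.trans_le h2) (half_pos hw)
      linarith
    have h5 := mul_le_mul_of_nonneg_left hcos (zero_le_one.trans hM1)
    have h6 := h5.trans_lt hlt
    rw [hM] at h6
    linarith

end Bridge

end LogSobolevTilt

/-! ### Choice of parameters -/

theorem mainTheorem6 (ℓ : ℝ) (hℓ : 0 < ℓ) :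
    (∃ w a b : ℝ, 0 < w ∧ 0 ≤ a ∧ a < b ∧
      LogSobolevTilt.logSobolevConst
          (LogSobolevTilt.uniformMeasure (LogSobolevTilt.bridge w a b))
        < ENNReal.ofReal (ℓ ^ 2) ∧
      ENNReal.ofReal (Real.exp (ℓ ^ 2))
        < LogSobolevTilt.logSobolevConst
            (LogSobolevTilt.tilt
              (LogSobolevTilt.uniformMeasure (LogSobolevTilt.bridge w a b))
              (fun x => ‖x‖ ^ 2))) ∧
    (ENNReal.ofReal (0.1 * Real.exp ℓ)
        < LogSobolevTilt.logSobolevConst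
            (LogSobolevTilt.uniformMeasure
              (segment ℝ !₂[-Real.exp ℓ, 0] !₂[Real.exp ℓ, 0])) ∧
      LogSobolevTilt.logSobolevConst
          (LogSobolevTilt.tilt
            (LogSobolevTilt.uniformMeasure
              (segment ℝ !₂[-Real.exp ℓ, 0] !₂[Real.exp ℓ, 0]))
            (fun x => ‖x‖ ^ 2))
        < 2) := by
  refine ⟨?_, ?_, ?_⟩
  -- The bridge then has length `4w = ℓ/2`. The `+ 1` in `D` makes the lower bound strict, and `a`
  -- gives equality in the hypothesis of `le_logSobolevConst_tilt_bridge`.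
  · set w := ℓ / 8 with hw
    have hw0 : 0 < w := by positivity
    set D := Real.exp (ℓ ^ 2) + 1 with hD
    have hD0 : 0 < D := by positivity
    set a := (4 * (D * (Real.pi / (2 * w)) ^ 2 * 4.01 + 1) + w ^ 2 / 4) / w with ha
    have ha0 : 0 ≤ a := by positivity
    have haw : a * w = 4 * (D * (Real.pi / (2 * w)) ^ 2 * 4.01 + 1) + w ^ 2 / 4 :=
      div_mul_cancel₀ _ hw0.ne'
    refine ⟨w, a, a + w, hw0, ha0, by linarith, ?_, ?_⟩
    · refine (LogSobolevTilt.logSobolevConst_uniform_bridge_le hw0 (by linarith)).trans_lt ?_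
      rw [ENNReal.ofReal_lt_ofReal_iff (by positivity)]
      have : 2 * w + 2 * (a + w - a) = ℓ / 2 := by rw [hw]; ring
      rw [this]
      nlinarith
    · refine lt_of_lt_of_le ?_
        (LogSobolevTilt.le_logSobolevConst_tilt_bridge hw0 ha0 hD0.le (by linarith))
      rw [ENNReal.ofReal_lt_ofReal_iff hD0]
      linarith
  · refine lt_of_lt_of_le ?_
      (LogSobolevTilt.le_logSobolevConst_uniform_segment (Real.exp_pos ℓ))
    -- The bound available is `0.101 L²` with `L = exp ℓ`; `L > 1` turns it into more than `0.1 L`.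
    have h1 : 1 < Real.exp ℓ := Real.one_lt_exp_iff.2 hℓ
    rw [ENNReal.ofReal_lt_ofReal_iff (by positivity)]
    nlinarith
  · refine (LogSobolevTilt.logSobolevConst_tilt_segment_le (Real.exp_pos ℓ)).trans_lt ?_
    rw [← ENNReal.ofReal_ofNat, ENNReal.ofReal_lt_ofReal_iff (by norm_num)]
    norm_num
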